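/- For a topological space $X$ and an integer $k\ge 1$ let $\exp_k(X)$ be the set of non-empty subsets of $X$ with at most $k$ elements, with the quotient topology given by the map $X^k\to\exp_k(X)$, $(x_1,\dots,x_k)\mapsto\{x_1,\dots,x_k\}$. There are canonical inclusions $\exp_1(X)\subset\exp_2(X)\subset\exp_3(X)$, and $X$ is identified with $\exp_1(X)$ by $x\mapsto\{x\}$. Let $S^3\subset\mathbb{C}^2$ be the unit sphere. **Theorem.** 1. $\exp_3(S^1)$ is homeomorphic to $S^3$. 2. There is a homeomorphism from $\exp_2(S^1)$ onto the Möbius band $[0,1]\times[-1,1]/\big((0,t)\sim(1,-t)\big)$ that carries $\exp_1(S^1)$ onto the boundary circle (the image of $[0,1]\times\{-1,1\}$). 3. Let $\Phi\colon\exp_3(S^1)\to S^3$ be any homeomorphism. Then $\Phi(\exp_2(S^1))$ is a Möbius band with one and a half full twists (three half twists) in $S^3$, with edge $\Phi(\exp_1(S^1))$. That is, some homeomorphism of $S^3$, possibly reversing the orientation, carries $\Phi(\exp_2(S^1))$ onto the standard band with unknotted core and three half twists $$\big\{(\cos\varphi\; e^{i\theta},\ \sin\varphi\; e^{3i\theta/2})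 : \theta\in\mathbb{R},\ |\varphi|\le \pi/4\big\}$$ and carries $\Phi(\exp_1(S^1))$ onto its edge, where $|\varphi|=\pi/4$. 4. For any homeomorphism $\Phi\colon\exp_3(S^1)\to S^3$, the embedding $S^1=\exp_1(S^1)\subset\exp_3(S^1)\xrightarrow{\Phi}S^3$, $z\mapsto\Phi(\{z\})$, is a trefoil knot: some homeomorphism $h$ of $S^3$, possibly reversing the orientation, satisfies $h(\Phi(\{z\}))=\tfrac{1}{\sqrt2}(z^2,z^3)$ for all $z\in S^1$. -/

import Mathlib

/-! ### Symmetric potencies -/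

/-- The set underlying the `k`-th symmetric potency of `X`: the non-empty subsets of `X` with at
most `k` elements. -/
def SymmetricPotency (k : ℕ) (X : Type*) : Type _ :=
  {A : Set X // A.Nonempty ∧ A.encard ≤ k}

namespace SymmetricPotency

/-- The canonical projection `(x₁, …, x_k) ↦ {x₁, …, x_k}` from the `k`-fold product. -/
def proj (k : ℕ) [NeZero k] (X : Type*) (x : Fin k → X) : SymmetricPotency k X :=
  ⟨Set.range x, Set.range_nonempty x, by
    rw [← Set.image_univ]
    exact (Set.encard_image_le x Set.univ).trans (by simp)⟩

/-- The `k`-th symmetric potency carries the quotient topology of the `k`-fold product. -/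
instance (k : ℕ) [NeZero k] (X : Type*) [TopologicalSpace X] :
    TopologicalSpace (SymmetricPotency k X) :=
  TopologicalSpace.coinduced (proj k X) inferInstance

/-- The canonical inclusion of symmetric potencies, `A ↦ A`. -/
def inclusion {j k : ℕ} (h : j ≤ k) (X : Type*) (A : SymmetricPotency j X) :
    SymmetricPotency k X :=
  ⟨A.1, A.2.1, A.2.2.trans (by exact_mod_cast h)⟩

/-- The map `X = exp₁(X) ⊆ exp_k(X)`, `x ↦ {x}`. -/
def point {k : ℕ} (hk : 1 ≤ k) (X : Type*) (x : X) : SymmetricPotency k X :=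
  inclusion hk X (proj 1 X fun _ => x)

end SymmetricPotency

/-! ### The Möbius band -/

/-- The Möbius band: the quotient space of `[0, 1] × [-1, 1]` in which `(0, t)` is glued
to `(1, -t)` for every `t`. -/
def MobiusBand : Type :=
  Quot fun p q : unitInterval × Set.Icc (-1 : ℝ) 1 =>
    p.1 = 0 ∧ q.1 = 1 ∧ (q.2 : ℝ) = -(p.2 : ℝ)

namespace MobiusBand

/-- The quotient map from the rectangle. -/
def mk (p : unitInterval × Set.Icc (-1 : ℝ) 1) : MobiusBand := Quot.mk _ p

instance : TopologicalSpace MobiusBand := TopologicalSpace.coinduced mk inferInstance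

/-- The boundary circle of the Möbius band: the image of `[0, 1] × {-1, 1}`. -/
def boundary : Set MobiusBand := mk '' {p | |(p.2 : ℝ)| = 1}

end MobiusBand

/-! ### Knots and twisted bands in the 3-sphere -/

/-- The 3-sphere, as the unit sphere of `ℂ²`. -/
abbrev ThreeSphere : Type := Metric.sphere (0 : EuclideanSpace ℂ (Fin 2)) 1

/-- The standard trefoil knot, i.e. the `(2, 3)` torus knot `z ↦ (z², z³) / √2`
on the Clifford torus. -/
noncomputable def trefoil (z : Circle) : ThreeSphere :=
  ⟨!₂[(z : ℂ) ^ 2 / (Real.sqrt 2 : ℂ), (z : ℂ) ^ 3 / (Real.sqrt 2 : ℂ)], by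
    have hz : ‖(z : ℂ)‖ = 1 := Circle.norm_coe z
    simp [EuclideanSpace.norm_eq, Fin.sum_univ_two, hz]
    norm_num⟩

/-- A map `S¹ → S³` is a trefoil knot if a homeomorphism of `S³` carries it to the
standard trefoil. The homeomorphism may reverse the orientation, since both mirror images are
trefoil knots. -/
def IsTrefoilKnot (f : Circle → ThreeSphere) : Prop :=
  ∃ h : ThreeSphere ≃ₜ ThreeSphere, ∀ z, h (f z) = trefoil z

/-- The point of `S³` at signed distance `φ` from the point `(e^{iθ}, 0)` of the great circle
`w = 0`, in the normal direction `(0, e^{inθ/2})`. -/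
noncomputable def bandPoint (n : ℤ) (θ φ : ℝ) : EuclideanSpace ℂ (Fin 2) :=
  !₂[(Real.cos φ : ℂ) * Complex.exp (θ * Complex.I),
    (Real.sin φ : ℂ) * Complex.exp ((n * θ / 2 : ℝ) * Complex.I)]

/-- The standard band with `n` half twists in `S³`. Its core is the unknotted great circle `w = 0`,
and its fibre over `(e^{iθ}, 0)` is the normal geodesic segment of length `π / 2` with midpoint
`(e^{iθ}, 0)` and direction `(0, e^{inθ/2})`. Relative to the constant normal direction `(0, 1)`,
along which the core has self-linking number zero, the segment makes `n` half turns while `θ` runs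
once around the core. For odd `n` this is a Möbius band. -/
def standardBand (n : ℤ) : Set ThreeSphere :=
  {p | ∃ θ φ : ℝ, |φ| ≤ Real.pi / 4 ∧ (p : EuclideanSpace ℂ (Fin 2)) = bandPoint n θ φ}

/-- The edge of the standard band: the endpoints of its fibres. -/
def standardBandEdge (n : ℤ) : Set ThreeSphere :=
  {p | ∃ θ φ : ℝ, |φ| = Real.pi / 4 ∧ (p : EuclideanSpace ℂ (Fin 2)) = bandPoint n θ φ}

/-- `M` is a band in `S³` with edge `K`, with unknotted core and `n` half twists (of either
handedness): some homeomorphism of `S³` carries `(M, K)` to the standard band with `n` half twists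
and its edge. -/
def IsHalfTwistedBand (n : ℤ) (M K : Set ThreeSphere) : Prop :=
  ∃ h : ThreeSphere ≃ₜ ThreeSphere, h '' M = standardBand n ∧ h '' K = standardBandEdge n

/-! An unordered triple in the circle (with multiplicity) is determined by its product `p` and
second symmetric function `e`, because the sum equals `p * conj e`. When `p = 1`, the possible `e`
fill the region where the discriminant of the cubic is nonpositive, and `w ↦ 2w + w̄²` carries the
closed disc bijectively onto it (`deltoid_injOn`, `exists_deltoid_eq`, `norm_eq_one_of_root`).
Rescaling by a cube root `γ` of `p` gives `e = 2w + w̄² p²` in general. Here `γ` has disappeared, so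
`(w, p)` are global coordinates identifying multisets of size three with the solid torus of pairs
`|w| ≤ 1`, `|p| = 1`.

Passing from multisets to sets only identifies `{a, a, b}` with `{a, b, b}`. These have coordinates
`(ab, a²b)` and `(ab, ab²)`, so the boundary torus `|w| = 1` is folded by `p ↦ w³ p̄`. The
normalized vector `(w, (p + w³ p̄ / |w|) / 2)` realizes this quotient as the 3-sphere:
`foldVec_fiber` shows that its fibres are exactly the identified pairs, and `exists_foldVec_eq` that
every direction is attained. Compactness of the source turns the continuous bijection into a
homeomorphism.

On pairs the vector is `(ab, ab(a + b)/2)`. With `a, b = e^{i(μ ± δ)}` this is `(e^{2iμ}, cos δ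
e^{3iμ})`, the band with three half twists, and for `a = b = z` it is `(z², z³)`, the trefoil
(`tripleMap_eq_bandPoint`, `tripleMap_self`). Any other homeomorphism to the sphere differs from
this one by a self-homeomorphism of the sphere. The Möbius band is matched with pairs separately:
the midpoint angle runs along it and the separation runs across it. -/

open ComplexConjugate

/-! ### The deltoid -/

/-- The map `w ↦ 2w + w̄²` from the unit disc onto the region bounded by the deltoid. -/
noncomputable def deltoid (w : ℂ) : ℂ := 2 * w + conj w ^ 2

/-- The discriminant of the self-inversive cubic `z³ - ē z² + e z - 1`. -/
noncomputable def selfInversiveDisc (e : ℂ) : ℝ :=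
  Complex.normSq e ^ 2 - 8 * (e ^ 3).re + 18 * Complex.normSq e - 27

theorem ofReal_selfInversiveDisc (e : ℂ) :
    (selfInversiveDisc e : ℂ) =
      (e * conj e) ^ 2 - 4 * (e ^ 3 + conj e ^ 3) + 18 * (e * conj e) - 27 := by
  have h : (((e ^ 3).re : ℝ) : ℂ) * 2 = e ^ 3 + conj e ^ 3 := by
    rw [← map_pow, Complex.add_conj]; push_cast; ring
  simp only [selfInversiveDisc, Complex.ofReal_sub, Complex.ofReal_add, Complex.ofReal_mul,
    Complex.ofReal_pow, ← Complex.mul_conj, Complex.ofReal_ofNat]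
  linear_combination (-4) * h

theorem selfInversiveDisc_deltoid (w : ℂ) :
    selfInversiveDisc (deltoid w) = (Complex.normSq w - 1) ^ 2 *
      (Complex.normSq w ^ 2 + 18 * Complex.normSq w - 27 + 8 * (w ^ 3).re) := by
  obtain ⟨x, y⟩ := w
  simp [selfInversiveDisc, deltoid, Complex.normSq_apply, pow_succ]
  ring

theorem re_cube_le_one {w : ℂ} (hw : ‖w‖ ≤ 1) : (w ^ 3).re ≤ 1 := by
  calc (w ^ 3).re ≤ ‖w ^ 3‖ := Complex.re_le_norm _
    _ = ‖w‖ ^ 3 := norm_pow _ _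
    _ ≤ 1 := pow_le_one₀ (norm_nonneg _) hw

/-- In the factorization the square is nonnegative, and on the disc the other factor is at most `1 +
18 - 27 + 8 = 0`. -/
theorem selfInversiveDisc_deltoid_nonpos {w : ℂ} (hw : ‖w‖ ≤ 1) :
    selfInversiveDisc (deltoid w) ≤ 0 := by
  rw [selfInversiveDisc_deltoid]
  have h1 : Complex.normSq w ≤ 1 := by
    rw [Complex.normSq_eq_norm_sq]; exact pow_le_one₀ (norm_nonneg _) hw
  have h0 := Complex.normSq_nonneg w
  have := re_cube_le_one hw
  refine mul_nonpos_of_nonneg_of_nonpos (sq_nonneg _) ?_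
  nlinarith

theorem selfInversiveDisc_deltoid_eq_zero {w : ℂ} (hw : ‖w‖ = 1) :
    selfInversiveDisc (deltoid w) = 0 := by
  rw [selfInversiveDisc_deltoid, Complex.normSq_eq_norm_sq, hw]; norm_num

/-- Strict star-shapedness about the origin: moving inwards from a point of the region leaves the
zero set of the discriminant. This is what keeps the segment in `exists_deltoid_eq` off the boundary
curve. -/
theorem selfInversiveDisc_smul_neg {e : ℂ} (he : selfInversiveDisc e ≤ 0) {t : ℝ}
    (h0 : 0 ≤ t) (h1 : t < 1) : selfInversiveDisc (t * e) < 0 := by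
  have key : selfInversiveDisc (t * e) =
      t ^ 4 * Complex.normSq e ^ 2 - 8 * t ^ 3 * (e ^ 3).re
        + 18 * t ^ 2 * Complex.normSq e - 27 := by
    have : ((t * e) ^ 3).re = t ^ 3 * (e ^ 3).re := by
      rw [mul_pow, ← Complex.ofReal_pow, Complex.re_ofReal_mul]
    rw [selfInversiveDisc, this, Complex.normSq_mul, Complex.normSq_ofReal]; ring
  have hre : (e ^ 3).re ^ 2 ≤ Complex.normSq e ^ 3 := by
    rw [← map_pow, Complex.normSq_apply]; nlinarith [sq_nonneg (e ^ 3).im]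
  have hN := Complex.normSq_nonneg e
  rw [key]
  rw [selfInversiveDisc] at he
  generalize Complex.normSq e = N at *
  generalize (e ^ 3).re = c at *
  obtain ⟨r, hr, rfl⟩ : ∃ r : ℝ, 0 ≤ r ∧ r ^ 2 = N := ⟨√N, Real.sqrt_nonneg _, Real.sq_sqrt hN⟩
  have hc : c ≤ r ^ 3 := by
    refine le_of_sq_le_sq ?_ (pow_nonneg hr 3)
    calc c ^ 2 ≤ (r ^ 2) ^ 3 := hre
      _ = (r ^ 3) ^ 2 := by ring
  rcases hr.eq_or_lt with rfl | hr
  · have : c = 0 := by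
      have : c ^ 2 ≤ 0 := by simpa using hre
      exact pow_eq_zero_iff two_ne_zero |>.1 (le_antisymm this (sq_nonneg _))
    subst this
    norm_num
  have hA : 0 < 1 + t + t ^ 2 + t ^ 3 := by positivity
  -- With `c ≤ r³`, the discriminant at `e` exceeds that at `t e` by at least `r² (1 - t)` times
  -- this quadratic in `r`. Completing the square leaves `2 (1 - t)² (1 + 4t + t²)`, which
  -- degenerates only at `t = 1`, where the cusps `r = 3` appear.
  have hq : 0 < (1 + t + t ^ 2 + t ^ 3) * r ^ 2 - 8 * (1 + t + t ^ 2) * r + 18 * (1 + t) := by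
    refine pos_of_mul_pos_right (a := 1 + t + t ^ 2 + t ^ 3) ?_ hA.le
    have h2 : 0 < 2 * (1 - t) ^ 2 * (1 + t ^ 2 + 4 * t) := by
      have := sub_pos.2 h1
      positivity
    have := sq_nonneg ((1 + t + t ^ 2 + t ^ 3) * r - 4 * (1 + t + t ^ 2))
    calc (0 : ℝ) < _ := add_pos_of_nonneg_of_pos this h2
      _ = _ := by ring
  have hpos := mul_pos (mul_pos (pow_pos hr 2) (sub_pos.2 h1)) hq
  have ht3 : 0 ≤ 1 - t ^ 3 := sub_nonneg.2 (pow_le_one₀ h0 h1.le)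
  have := mul_le_mul_of_nonneg_left hc ht3
  nlinarith

/-- Two distinct points with the same image would satisfy `|w + w'| = 2`, and the parallelogram law
then forces `w = w'` in the disc. -/
theorem deltoid_injOn {w w' : ℂ} (hw : ‖w‖ ≤ 1) (hw' : ‖w'‖ ≤ 1)
    (h : deltoid w = deltoid w') : w = w' := by
  by_contra hne
  have hd : 0 < ‖w - w'‖ := norm_pos_iff.2 (sub_ne_zero.2 hne)
  have h1 : 2 * (w - w') = -(conj (w - w') * conj (w + w')) := by
    simp only [deltoid, map_sub, map_add] at *
    linear_combination h
  have h2 := congrArg norm h1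
  rw [norm_neg, norm_mul, norm_mul, RCLike.norm_conj, RCLike.norm_conj, mul_comm,
    mul_right_inj' hd.ne'] at h2
  have h3 := parallelogram_law_with_norm ℝ w w'
  simp at h2
  nlinarith [norm_nonneg w, norm_nonneg w', mul_pos hd hd]

/-- On a ball of radius `r < 1` the term `w̄²` is Lipschitz with constant `2r < 2`, so it is a small
perturbation of the invertible map `2w`, and the quantitative open mapping criterion applies. -/
theorem isOpen_deltoid_image_ball : IsOpen (deltoid '' Metric.ball 0 1) := by
  rw [isOpen_iff_mem_nhds]
  rintro _ ⟨w, hw, rfl⟩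
  rw [mem_ball_zero_iff] at hw
  obtain ⟨r, hr, hr1⟩ := exists_between hw
  lift r to NNReal using (norm_nonneg _).trans hr.le
  let f' : ℂ →L[ℝ] ℂ := (2 : ℝ) • ContinuousLinearMap.id ℝ ℂ
  let g : f'.NonlinearRightInverse :=
    { toFun := fun y => y / 2
      nnnorm := 1 / 2
      bound' := fun y => by simp [div_eq_inv_mul]
      right_inv' := fun y => by simp [f', mul_div_cancel₀] }
  have happ : ApproximatesLinearOn deltoid f' (Metric.ball 0 (r : ℝ)) (2 * r) := by
    intro x hx y hy
    rw [mem_ball_zero_iff] at hx hy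
    have : deltoid x - deltoid y - f' (x - y) = conj (x + y) * conj (x - y) := by
      simp [deltoid, f']; ring
    rw [this, norm_mul, RCLike.norm_conj, RCLike.norm_conj]
    refine mul_le_mul_of_nonneg_right ?_ (norm_nonneg _)
    exact (norm_add_le x y).trans (by push_cast; linarith)
  have hopen : IsOpen (deltoid '' Metric.ball 0 (r : ℝ)) := by
    refine happ.open_image g Metric.isOpen_ball (Or.inr ?_)
    rw [← NNReal.coe_lt_coe]
    change ((2 * r : NNReal) : ℝ) < ((1 / 2 : NNReal)⁻¹ : NNReal)
    push_cast
    linarith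
  exact Filter.mem_of_superset (hopen.mem_nhds ⟨w, mem_ball_zero_iff.2 hr, rfl⟩)
    (Set.image_mono (Metric.ball_subset_ball hr1.le))

/-- The deltoid region is the image of the closed disc. -/
theorem exists_deltoid_eq {e : ℂ} (he : selfInversiveDisc e ≤ 0) :
    ∃ w, ‖w‖ ≤ 1 ∧ deltoid w = e := by
  have hcont : Continuous deltoid := by unfold deltoid; fun_prop
  have hclosed : IsClosed (deltoid '' Metric.closedBall 0 1) :=
    ((isCompact_closedBall 0 1).image hcont).isClosed
  let f : ℝ → ℂ := fun t => t * e
  have hf : Continuous f := by fun_prop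
  have hpre : IsPreconnected (Set.Ico (0 : ℝ) 1) := isPreconnected_Ico
  -- Connectedness along the segment from `0` to `e`: the image of the open disc is open, the
  -- complement of the image of the closed disc is open, and the image of the unit circle is missed
  -- because the discriminant is negative for `t < 1`.
  have hsub : Set.Ico (0 : ℝ) 1 ⊆ f ⁻¹' (deltoid '' Metric.ball 0 1) := by
    refine hpre.subset_left_of_subset_union (isOpen_deltoid_image_ball.preimage hf)
      (hclosed.isOpen_compl.preimage hf) ?_ ?_ ⟨0, by simp, 0, by simp, by simp [deltoid, f]⟩
    · rw [Set.disjoint_left]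
      exact fun t h1 h2 => h2 (Set.image_mono Metric.ball_subset_closedBall h1)
    · intro t ht
      by_cases h : f t ∈ deltoid '' Metric.closedBall 0 1
      · left
        obtain ⟨w, hw, hwt⟩ := h
        rw [mem_closedBall_zero_iff] at hw
        refine ⟨w, mem_ball_zero_iff.2 (lt_of_le_of_ne hw fun h1 => ?_), hwt⟩
        have := selfInversiveDisc_smul_neg he ht.1 ht.2
        exact this.ne ((congrArg selfInversiveDisc hwt).symm.trans
          (selfInversiveDisc_deltoid_eq_zero h1))
      · exact Or.inr h
  have hcl : (1 : ℝ) ∈ closure (Set.Ico (0 : ℝ) 1) := by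
    rw [closure_Ico (by norm_num)]; simp
  have : f 1 ∈ deltoid '' Metric.closedBall 0 1 :=
    closure_minimal (hsub.trans (Set.preimage_mono (Set.image_mono Metric.ball_subset_closedBall)))
      (hclosed.preimage hf) hcl
  obtain ⟨w, hw, h⟩ := this
  exact ⟨w, mem_closedBall_zero_iff.1 hw, by simpa [f] using h⟩

/-! ### Self-inversive cubics and roots on the unit circle -/

theorem selfInversiveDisc_eq_of_roots {e a b c : ℂ} (h3 : a * b * c = 1)
    (h2 : a * b + b * c + c * a = e) (h1 : a + b + c = conj e) :
    (selfInversiveDisc e : ℂ) = ((a - b) * (b - c) * (c - a)) ^ 2 := by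
  rw [ofReal_selfInversiveDisc, ← h1, ← h2]
  linear_combination (4 * (a + b + c) ^ 3 - 18 * (a + b + c) * (a * b + b * c + c * a)
    + 27 * (1 + a * b * c)) * h3

theorem conj_eq_inv_of_norm_eq_one {z : ℂ} (hz : ‖z‖ = 1) : conj z = z⁻¹ :=
  (Complex.inv_eq_conj hz).symm

theorem mul_conj_of_norm_eq_one {z : ℂ} (hz : ‖z‖ = 1) : z * conj z = 1 := by
  rw [Complex.mul_conj, Complex.normSq_eq_norm_sq, hz]; norm_num

theorem norm_eq_one_of_pow {z w : ℂ} {n : ℕ} (hn : n ≠ 0) (hw : ‖w‖ = 1) (h : z ^ n = w) :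
    ‖z‖ = 1 := by
  have := congrArg norm h
  rw [norm_pow, hw] at this
  exact (pow_eq_one_iff_of_nonneg (norm_nonneg _) hn).1 this

/-- Three points of the circle with product one have their second symmetric function in the
deltoid region. -/
theorem selfInversiveDisc_nonpos_of_norm_eq_one {a b c : ℂ} (ha : ‖a‖ = 1) (hb : ‖b‖ = 1)
    (hc : ‖c‖ = 1) (h : a * b * c = 1) : selfInversiveDisc (a * b + b * c + c * a) ≤ 0 := by
  have ca : conj a = b * c := by
    linear_combination (-conj a) * h + (b * c) * mul_conj_of_norm_eq_one ha
  have cb : conj b = c * a := by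
    linear_combination (-conj b) * h + (c * a) * mul_conj_of_norm_eq_one hb
  have cc : conj c = a * b := by
    linear_combination (-conj c) * h + (a * b) * mul_conj_of_norm_eq_one hc
  have h1 : a + b + c = conj (a * b + b * c + c * a) := by
    simp only [map_add, map_mul, ca, cb, cc]
    linear_combination (-(a + b + c)) * h
  -- The root of the discriminant is purely imaginary, so its square is minus its squared norm.
  have hδ : conj ((a - b) * (b - c) * (c - a)) = -((a - b) * (b - c) * (c - a)) := by
    simp only [map_sub, map_mul, ca, cb, cc]
    linear_combination (-((a - b) * (b - c) * (c - a))) * h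
  have := selfInversiveDisc_eq_of_roots h rfl h1
  rw [sq, ← neg_neg (((a - b) * (b - c) * (c - a)) * _), ← mul_neg, ← hδ, Complex.mul_conj,
    ← Complex.ofReal_neg, Complex.ofReal_inj] at this
  rw [this]
  exact neg_nonpos.2 (Complex.normSq_nonneg _)

/-- If two roots are exchanged by inversion in the circle, then `b = 1/ā` and `c = ā/a`, and the
discriminant times `|a|⁸` is the square of the real number `(|a|² - 1) |a - ā²|²`. Nonpositivity
makes it vanish, and either factor being zero gives `|a| = 1`. -/
theorem norm_eq_one_of_mul_conj {e a b c : ℂ} (he : selfInversiveDisc e ≤ 0)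
    (h3 : a * b * c = 1) (h2 : a * b + b * c + c * a = e) (h1 : a + b + c = conj e)
    (hab : b * conj a = 1) : ‖a‖ = 1 := by
  have hD := selfInversiveDisc_eq_of_roots h3 h2 h1
  have ha : a ≠ 0 := by rintro rfl; simp at h3
  have ha' : conj a ≠ 0 := by simpa using ha
  have hb : b = (conj a)⁻¹ := eq_inv_of_mul_eq_one_left hab
  have hc : c = conj a / a := by
    rw [hb] at h3; field_simp at h3 ⊢; linear_combination h3
  have key : (selfInversiveDisc e : ℂ) * (Complex.normSq a : ℂ) ^ 4 =
      (((Complex.normSq a - 1) * Complex.normSq (a - conj a ^ 2) : ℝ) : ℂ) ^ 2 := by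
    rw [hD, hb, hc]
    push_cast
    rw [← Complex.mul_conj, ← Complex.mul_conj]
    simp only [map_sub, map_pow, Complex.conj_conj]
    field_simp
  have key' : selfInversiveDisc e * Complex.normSq a ^ 4 =
      ((Complex.normSq a - 1) * Complex.normSq (a - conj a ^ 2)) ^ 2 := by exact_mod_cast key
  have hz : (Complex.normSq a - 1) * Complex.normSq (a - conj a ^ 2) = 0 := by
    have := mul_nonpos_of_nonpos_of_nonneg he (pow_nonneg (Complex.normSq_nonneg a) 4)
    rw [key'] at this
    exact pow_eq_zero_iff two_ne_zero |>.1 (le_antisymm this (sq_nonneg _))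
  have hn : ‖a‖ ≠ 0 := norm_ne_zero_iff.2 ha
  rcases mul_eq_zero.1 hz with h | h
  · rw [Complex.normSq_eq_norm_sq, sub_eq_zero] at h
    exact (pow_eq_one_iff_of_nonneg (norm_nonneg _) two_ne_zero).1 h
  · have := congrArg norm (sub_eq_zero.1 (Complex.normSq_eq_zero.1 h))
    rw [norm_pow, RCLike.norm_conj, sq] at this
    exact (mul_eq_left₀ hn).1 this.symm

theorem norm_eq_one_of_root {e a b c : ℂ} (he : selfInversiveDisc e ≤ 0)
    (h3 : a * b * c = 1) (h2 : a * b + b * c + c * a = e) (h1 : a + b + c = conj e) :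
    ‖a‖ = 1 := by
  have h1' : conj a + conj b + conj c = e := by
    rw [← map_add, ← map_add, h1, Complex.conj_conj]
  have h0 : a ^ 3 - conj e * a ^ 2 + e * a - 1 = 0 := by
    rw [← h1, ← h2, ← h3]; ring
  have h0' := congrArg conj h0
  simp only [map_sub, map_add, map_mul, map_pow, Complex.conj_conj, map_one, map_zero] at h0'
  -- The cubic is self-inversive, so `1/ā` is again one of its roots `a`, `b`, `c`.
  have hprod : (1 - a * conj a) * (1 - b * conj a) * (1 - c * conj a) = 0 := by
    linear_combination (-1) * h0' - conj a * h1 + conj a ^ 2 * h2 - conj a ^ 3 * h3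
  rcases mul_eq_zero.1 hprod with h | h
  · rcases mul_eq_zero.1 h with h | h
    · rw [Complex.mul_conj, sub_eq_zero, Complex.normSq_eq_norm_sq] at h
      have : (1 : ℝ) = ‖a‖ ^ 2 := by exact_mod_cast h
      exact (pow_eq_one_iff_of_nonneg (norm_nonneg _) two_ne_zero).1 this.symm
    · exact norm_eq_one_of_mul_conj he h3 h2 h1 (sub_eq_zero.1 h).symm
  · exact norm_eq_one_of_mul_conj (b := c) (c := b) he (by rw [← h3]; ring) (by rw [← h2]; ring)
      (by rw [← h1]; ring) (sub_eq_zero.1 h).symm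

theorem exists_three_roots (e : ℂ) :
    ∃ a b c : ℂ, a * b * c = 1 ∧ a * b + b * c + c * a = e ∧ a + b + c = conj e := by
  let P : Cubic ℂ := ⟨1, -conj e, e, -1⟩
  have hP : P.a ≠ 0 := one_ne_zero
  obtain ⟨a, b, c, h⟩ := (Cubic.splits_iff_roots_eq_three (φ := RingHom.id ℂ) hP).1
    (IsAlgClosed.splits _)
  have h1 := Cubic.b_eq_three_roots hP h
  have h2 := Cubic.c_eq_three_roots hP h
  have h3 := Cubic.d_eq_three_roots hP h
  simp [P] at h1 h2 h3
  exact ⟨a, b, c, by linear_combination -h3, by linear_combination -h2, by linear_combination h1⟩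

/-! ### Solid-torus coordinates on triples -/

/-- Every point of the disc comes from three points of the circle with prescribed product. -/
theorem exists_circle_triple {w p : ℂ} (hw : ‖w‖ ≤ 1) (hp : ‖p‖ = 1) :
    ∃ a b c : Circle, (a * b * c : ℂ) = p ∧
      (a * b + b * c + c * a : ℂ) = 2 * w + conj w ^ 2 * p ^ 2 := by
  -- Dividing the three points by a cube root of `p` reduces to product one; `w` then becomes `w
  -- γ̄²`.
  obtain ⟨γ, hγ⟩ := IsAlgClosed.exists_pow_nat_eq p (n := 3) (by norm_num)
  have hγ1 : ‖γ‖ = 1 := norm_eq_one_of_pow three_ne_zero hp hγ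
  have hγc := mul_conj_of_norm_eq_one hγ1
  obtain ⟨a, b, c, h3, h2, h1⟩ := exists_three_roots (deltoid (w * conj γ ^ 2))
  have he : selfInversiveDisc (deltoid (w * conj γ ^ 2)) ≤ 0 :=
    selfInversiveDisc_deltoid_nonpos (by simpa [hγ1] using hw)
  have ha := norm_eq_one_of_root he h3 h2 h1
  have hb := norm_eq_one_of_root (a := b) (b := c) (c := a) he (by rw [← h3]; ring)
    (by rw [← h2]; ring) (by rw [← h1]; ring)
  have hc := norm_eq_one_of_root (a := c) (b := a) (c := b) he (by rw [← h3]; ring)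
    (by rw [← h2]; ring) (by rw [← h1]; ring)
  refine ⟨⟨γ * a, by simp [Submonoid.unitSphere, hγ1, ha]⟩,
    ⟨γ * b, by simp [Submonoid.unitSphere, hγ1, hb]⟩,
    ⟨γ * c, by simp [Submonoid.unitSphere, hγ1, hc]⟩, ?_, ?_⟩
  · change γ * a * (γ * b) * (γ * c) = p
    rw [← hγ]; linear_combination γ ^ 3 * h3
  · change γ * a * (γ * b) + γ * b * (γ * c) + γ * c * (γ * a) = _
    simp only [deltoid, map_mul, map_pow, Complex.conj_conj] at h2
    have hγ2 : γ ^ 2 * conj γ ^ 2 = 1 := by rw [← mul_pow, hγc, one_pow]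
    rw [← hγ]
    linear_combination γ ^ 2 * h2 + 2 * w * hγ2

theorem exists_disc_parameter (a b c : Circle) :
    ∃ w : ℂ, ‖w‖ ≤ 1 ∧
      (a * b + b * c + c * a : ℂ) = 2 * w + conj w ^ 2 * (a * b * c : ℂ) ^ 2 := by
  obtain ⟨γ, hγ⟩ := IsAlgClosed.exists_pow_nat_eq (a * b * c : ℂ) (n := 3) (by norm_num)
  have hγ1 : ‖γ‖ = 1 := norm_eq_one_of_pow three_ne_zero (by simp [Circle.norm_coe]) hγ
  have hγc := mul_conj_of_norm_eq_one hγ1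
  have hγ2 : γ ^ 2 * conj γ ^ 2 = 1 := by rw [← mul_pow, hγc, one_pow]
  have hγ3 : γ ^ 3 * conj γ ^ 3 = 1 := by rw [← mul_pow, hγc, one_pow]
  obtain ⟨w, hw, h⟩ := exists_deltoid_eq (selfInversiveDisc_nonpos_of_norm_eq_one
    (a := a * conj γ) (b := b * conj γ) (c := c * conj γ)
    (by simp [Circle.norm_coe, hγ1]) (by simp [Circle.norm_coe, hγ1])
    (by simp [Circle.norm_coe, hγ1])
    (by linear_combination hγ3 - conj γ ^ 3 * hγ))
  refine ⟨w * γ ^ 2, by simpa [hγ1] using hw, ?_⟩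
  rw [← hγ]
  simp only [deltoid, map_mul, map_pow] at h ⊢
  have hγ4 : γ ^ 4 * conj γ ^ 4 = 1 := by rw [← mul_pow, hγc, one_pow]
  linear_combination (-γ ^ 2) * h - (a * b + b * c + c * a : ℂ) * hγ2 - conj w ^ 2 * γ ^ 2 * hγ4

theorem disc_parameter_unique {w w' p : ℂ} (hp : ‖p‖ = 1) (hw : ‖w‖ ≤ 1) (hw' : ‖w'‖ ≤ 1)
    (h : 2 * w + conj w ^ 2 * p ^ 2 = 2 * w' + conj w' ^ 2 * p ^ 2) : w = w' := by
  obtain ⟨γ, hγ⟩ := IsAlgClosed.exists_pow_nat_eq p (n := 3) (by norm_num)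
  have hγ1 : ‖γ‖ = 1 := norm_eq_one_of_pow three_ne_zero hp hγ
  have hγ0 : γ ≠ 0 := norm_ne_zero_iff.1 (by rw [hγ1]; exact one_ne_zero)
  have hγc := mul_conj_of_norm_eq_one hγ1
  have hγ2 : γ ^ 2 * conj γ ^ 2 = 1 := by rw [← mul_pow, hγc, one_pow]
  have := deltoid_injOn (w := w * conj γ ^ 2) (w' := w' * conj γ ^ 2)
    (by simpa [hγ1] using hw) (by simpa [hγ1] using hw') (by
      simp only [deltoid, map_mul, map_pow, Complex.conj_conj]
      rw [← hγ] at h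
      linear_combination conj γ ^ 2 * h -
        (conj w ^ 2 - conj w' ^ 2) * γ ^ 4 * hγ2)
  exact mul_right_cancel₀ (pow_ne_zero 2 (by simpa using hγ0)) this

/-! ### The homeomorphism from the third symmetric potency of the circle to the 3-sphere -/

/-- The point `w` of the disc with `ab + bc + ca = 2w + w̄² (abc)²`. -/
noncomputable def discParam (a b c : Circle) : ℂ := (exists_disc_parameter a b c).choose

theorem norm_discParam_le (a b c : Circle) : ‖discParam a b c‖ ≤ 1 :=
  (exists_disc_parameter a b c).choose_spec.1

theorem discParam_spec (a b c : Circle) :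
    (a * b + b * c + c * a : ℂ) =
      2 * discParam a b c + conj (discParam a b c) ^ 2 * (a * b * c : ℂ) ^ 2 :=
  (exists_disc_parameter a b c).choose_spec.2

theorem norm_circle_mul (a b c : Circle) : ‖(a * b * c : ℂ)‖ = 1 := by
  simp [Circle.norm_coe]

theorem discParam_eq {a b c : Circle} {w : ℂ} (hw : ‖w‖ ≤ 1)
    (h : (a * b + b * c + c * a : ℂ) = 2 * w + conj w ^ 2 * (a * b * c : ℂ) ^ 2) :
    discParam a b c = w :=
  disc_parameter_unique (norm_circle_mul a b c) (norm_discParam_le a b c) hw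
    ((discParam_spec a b c).symm.trans h)

theorem discParam_swap_left (a b c : Circle) : discParam a b c = discParam b a c :=
  discParam_eq (norm_discParam_le b a c) (by linear_combination discParam_spec b a c)

theorem discParam_swap_right (a b c : Circle) : discParam a b c = discParam a c b :=
  discParam_eq (norm_discParam_le a c b) (by linear_combination discParam_spec a c b)

theorem Circle.coe_mul_conj (a : Circle) : (a : ℂ) * conj (a : ℂ) = 1 :=
  mul_conj_of_norm_eq_one (Circle.norm_coe a)

/-- Here `w̄ p = a`, so `2w + w̄² p² = 2ab + a²`. Triples with a repetition thus lie on the boundary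
torus `|w| = 1`. -/
theorem discParam_self_left (a b : Circle) : discParam a a b = a * b := by
  refine discParam_eq (by simp [Circle.norm_coe]) ?_
  have ha := Circle.coe_mul_conj a
  have hb := Circle.coe_mul_conj b
  have : conj (a * b : ℂ) * (a * a * b) = a := by
    rw [map_mul]; linear_combination a * ha + a * (a * conj (a : ℂ)) * hb
  rw [← mul_pow, this]; ring

/-- The preimage of a closed set is the projection of a closed part of the graph along the compact
factor. This gives continuity of the disc parameter, which is known only through its defining
equation. -/
theorem continuous_of_isClosed_graph {X Y : Type*} [TopologicalSpace X] [TopologicalSpace Y]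
    [CompactSpace Y] {f : X → Y} (h : IsClosed {p : X × Y | f p.1 = p.2}) : Continuous f := by
  rw [continuous_iff_isClosed]
  intro s hs
  convert isClosedMap_fst_of_compactSpace _ (h.inter (hs.preimage continuous_snd)) using 1
  ext x
  simp

theorem continuous_discParam :
    Continuous fun x : Fin 3 → Circle => discParam (x 0) (x 1) (x 2) := by
  let f : (Fin 3 → Circle) → Metric.closedBall (0 : ℂ) 1 := fun x =>
    ⟨discParam (x 0) (x 1) (x 2), mem_closedBall_zero_iff.2 (norm_discParam_le _ _ _)⟩
  suffices hf : Continuous f from continuous_subtype_val.comp hf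
  refine continuous_of_isClosed_graph ?_
  have : {p : (Fin 3 → Circle) × Metric.closedBall (0 : ℂ) 1 | f p.1 = p.2} =
      {p | (p.1 0 * p.1 1 + p.1 1 * p.1 2 + p.1 2 * p.1 0 : ℂ) =
        2 * (p.2 : ℂ) + conj (p.2 : ℂ) ^ 2 * (p.1 0 * p.1 1 * p.1 2 : ℂ) ^ 2} := by
    ext ⟨x, w⟩
    simp only [Set.mem_ofPred_eq, f, Subtype.ext_iff]
    exact ⟨fun h => h ▸ discParam_spec _ _ _,
      fun h => discParam_eq (mem_closedBall_zero_iff.1 w.2) h⟩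
  rw [this]
  exact isClosed_eq (by fun_prop) (by fun_prop)

/-! ### Folding the boundary of the solid torus -/

/-- The vector `(w, (p + w³ p̄ / |w|) / 2)`. -/
noncomputable def foldVec (w p : ℂ) : EuclideanSpace ℂ (Fin 2) :=
  !₂[w, (p + w ^ 3 / ‖w‖ * conj p) / 2]

theorem foldVec_ne_zero {w p : ℂ} (hp : ‖p‖ = 1) : foldVec w p ≠ 0 := by
  intro h
  have h0 : w = 0 := by simpa [foldVec] using congrArg (fun v => v 0) h
  have h1 : (p + w ^ 3 / ‖w‖ * conj p) / 2 = 0 := by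
    exact congrArg (fun v : EuclideanSpace ℂ (Fin 2) => v 1) h
  subst h0
  simp at h1
  simp [h1] at hp

/-- Only `w = 0` is delicate: the value there is `0` by the convention for division by zero, and the
norm of the quotient is `|w|²`. -/
theorem continuous_cube_div_norm : Continuous fun w : ℂ => w ^ 3 / (‖w‖ : ℂ) := by
  rw [continuous_iff_continuousAt]
  intro w
  rcases eq_or_ne w 0 with rfl | hw
  · rw [ContinuousAt, tendsto_iff_norm_sub_tendsto_zero]
    have h : Filter.Tendsto (fun w : ℂ => ‖w‖ ^ 2) (nhds 0) (nhds 0) := by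
      have : Continuous fun w : ℂ => ‖w‖ ^ 2 := by fun_prop
      simpa using this.tendsto 0
    refine h.congr fun z => ?_
    rcases eq_or_ne z 0 with rfl | hz
    · simp
    · have := norm_ne_zero_iff.2 hz
      simp
      field_simp
  · have : (‖w‖ : ℂ) ≠ 0 := by simpa using hw
    fun_prop (disch := assumption)

theorem continuous_foldVec : Continuous fun q : ℂ × ℂ => foldVec q.1 q.2 := by
  have := continuous_cube_div_norm
  have h1 : Continuous fun q : ℂ × ℂ => (q.2 + q.1 ^ 3 / (‖q.1‖ : ℂ) * conj q.2) / 2 :=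
    ((continuous_snd.add ((this.comp continuous_fst).mul
      (Complex.continuous_conj.comp continuous_snd))).div_const 2)
  refine (PiLp.continuous_toLp 2 _).comp (continuous_pi fun i => ?_)
  fin_cases i
  · exact continuous_fst
  · exact h1

theorem foldVec_fiber {w w' p p' : ℂ} {l : ℝ} (hp : ‖p‖ = 1) (hp' : ‖p'‖ = 1) (hw : ‖w‖ ≤ 1)
    (hw' : ‖w'‖ ≤ 1) (hl : 0 < l) (h : foldVec w' p' = (l : ℂ) • foldVec w p) :
    w' = w ∧ (p' = p ∨ ‖w‖ = 1 ∧ p * p' = w ^ 3) := by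
  have h0 : w' = l * w := by simpa [foldVec] using congrArg (fun v => v 0) h
  have h1 : (p' + w' ^ 3 / ‖w'‖ * conj p') / 2 = l * ((p + w ^ 3 / ‖w‖ * conj p) / 2) := by
    simpa [foldVec] using congrArg (fun v => v 1) h
  have hl0 : (l : ℂ) ≠ 0 := by exact_mod_cast hl.ne'
  have hn' : ‖w'‖ = l * ‖w‖ := by rw [h0, norm_mul, Complex.norm_real, Real.norm_of_nonneg hl.le]
  have hl1 (h : (p' : ℂ) = l * p) : l = 1 := by
    have := congrArg norm h
    rw [norm_mul, Complex.norm_real, Real.norm_of_nonneg hl.le, hp, hp'] at this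
    linarith
  rcases eq_or_ne w 0 with rfl | hw0
  · obtain rfl : w' = 0 := by simpa using h0
    have h2 : p' = l * p := by simp at h1; linear_combination 2 * h1
    exact ⟨rfl, Or.inl (by rw [h2, hl1 h2]; simp)⟩
  · have hp0 : p ≠ 0 := norm_ne_zero_iff.1 (by rw [hp]; exact one_ne_zero)
    have hp0' : p' ≠ 0 := norm_ne_zero_iff.1 (by rw [hp']; exact one_ne_zero)
    have hR : 0 < ‖w‖ := norm_pos_iff.2 hw0
    have hR0 : (‖w‖ : ℂ) ≠ 0 := by exact_mod_cast hR.ne'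
    rw [hn', h0, conj_eq_inv_of_norm_eq_one hp, conj_eq_inv_of_norm_eq_one hp'] at h1
    push_cast at h1
    -- Clearing denominators, the second coordinate factors. The first factor is the case of equal
    -- points; the second has norms `l |w|² = 1`, and with `l |w| = |w'| ≤ 1` this forces `|w| = 1`
    -- and hence the fold relation.
    have hfac : (p' - l * p) * (p * p' * ‖w‖ - l * w ^ 3) = 0 := by
      field_simp at h1
      linear_combination h1
    rcases mul_eq_zero.1 hfac with h2 | h2
    · have h2 := sub_eq_zero.1 h2
      have hl1 := hl1 h2
      rw [hl1] at h0 h2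
      exact ⟨by simpa using h0, Or.inl (by simpa using h2)⟩
    · have h2 := sub_eq_zero.1 h2
      have h3 := congrArg norm h2
      simp only [norm_mul, hp, hp', norm_pow, Complex.norm_real, norm_norm,
        Real.norm_of_nonneg hl.le] at h3
      have h4 : ‖w‖ = 1 := by
        have h5 : l * ‖w‖ * ‖w‖ = 1 := mul_right_cancel₀ hR.ne' (by linear_combination -h3)
        refine le_antisymm hw ?_
        rw [← h5]
        exact mul_le_of_le_one_left hR.le (hn' ▸ hw')
      have h5 : l = 1 := by rw [h4] at h3; linarith
      rw [h4, h5] at h2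
      rw [h5] at h0
      exact ⟨by simpa using h0, Or.inr ⟨h4, by simpa using h2⟩⟩

theorem exists_foldVec_eq {f g : ℂ} (h : ¬(f = 0 ∧ g = 0)) :
    ∃ (w p : ℂ) (l : ℝ), ‖w‖ ≤ 1 ∧ ‖p‖ = 1 ∧ 0 < l ∧ foldVec w p = (l : ℂ) • !₂[f, g] := by
  rcases eq_or_ne f 0 with rfl | hf
  · have hg : g ≠ 0 := fun hg => h ⟨rfl, hg⟩
    have hg' : 0 < ‖g‖ := norm_pos_iff.2 hg
    refine ⟨0, g / ‖g‖, 1 / (2 * ‖g‖), by simp, by simp [hg], by positivity, ?_⟩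
    ext i
    fin_cases i
    · simp [foldVec]
    · simp [foldVec]; ring
  · have hF : 0 < ‖f‖ := norm_pos_iff.2 hf
    have hF0 : (‖f‖ : ℂ) ≠ 0 := by exact_mod_cast hF.ne'
    -- Seeking `w = f/|P|` and `p = P/|P|` turns the second coordinate into this quadratic, since
    -- `f³/|f|` scales with degree two. Its roots have moduli with product `|f|²`, so one has
    -- modulus at least `|f|`, which is the condition `|w| ≤ 1`.
    obtain ⟨P, hP, hroot⟩ : ∃ P : ℂ, ‖f‖ ≤ ‖P‖ ∧ P ^ 2 - 2 * g * P + f ^ 3 / ‖f‖ = 0 := by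
      obtain ⟨s, hs⟩ := IsAlgClosed.exists_pow_nat_eq (g ^ 2 - f ^ 3 / ‖f‖) (n := 2) (by norm_num)
      have hprod : ‖g + s‖ * ‖g - s‖ = ‖f‖ ^ 2 := by
        have : (g + s) * (g - s) = f ^ 3 / ‖f‖ := by linear_combination -hs
        rw [← norm_mul, this]
        simp
        field_simp
      rcases le_or_gt ‖f‖ ‖g + s‖ with h1 | h1
      · exact ⟨g + s, h1, by linear_combination hs⟩
      · refine ⟨g - s, ?_, by linear_combination hs⟩
        by_contra! h2
        nlinarith [norm_nonneg (g + s), norm_nonneg (g - s)]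
    have hP' : 0 < ‖P‖ := hF.trans_le hP
    have hP0 : P ≠ 0 := norm_pos_iff.1 hP'
    have hPn : (‖P‖ : ℂ) ≠ 0 := by exact_mod_cast hP'.ne'
    have hp1 : ‖P / (‖P‖ : ℂ)‖ = 1 := by simp [hP0]
    refine ⟨f / ‖P‖, P / ‖P‖, 1 / ‖P‖, ?_, hp1, by positivity, ?_⟩
    · simpa using div_le_one_of_le₀ hP hP'.le
    · ext i
      fin_cases i
      · simp [foldVec]; ring
      · have hnorm : ‖f / (‖P‖ : ℂ)‖ = ‖f‖ / ‖P‖ := by simp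
        simp only [foldVec, hnorm, conj_eq_inv_of_norm_eq_one hp1]
        simp
        field_simp
        field_simp at hroot
        linear_combination hroot

/-! ### The map from triples to the sphere and its fibres -/

/-- A continuous invariant of triples of points of the circle, with values in the 3-sphere. -/
noncomputable def tripleMap (a b c : Circle) : ThreeSphere :=
  ⟨((‖foldVec (discParam a b c) (a * b * c)‖⁻¹ : ℝ) : ℂ) • foldVec (discParam a b c) (a * b * c), by
    have := norm_ne_zero_iff.2 (foldVec_ne_zero (w := discParam a b c) (norm_circle_mul a b c))
    rw [mem_sphere_zero_iff_norm, norm_smul]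
    simp [this]⟩

theorem tripleMap_swap_left (a b c : Circle) : tripleMap a b c = tripleMap b a c := by
  unfold tripleMap
  simp only [discParam_swap_left a b c, mul_comm (a : ℂ) b]

theorem tripleMap_swap_right (a b c : Circle) : tripleMap a b c = tripleMap a c b := by
  unfold tripleMap
  simp only [discParam_swap_right a b c, mul_right_comm (a : ℂ) b c]

/-- The fold averages `a²b` with its partner `ab²`. The result is symmetric in `a` and `b`, which
gives `tripleMap_fold`. -/
theorem foldVec_pair (a b : Circle) :
    foldVec (a * b) (a * a * b) = !₂[(a * b : ℂ), (a * b * (a + b) / 2 : ℂ)] := by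
  have ha := Circle.coe_mul_conj a
  have hb := Circle.coe_mul_conj b
  have hn : ‖(a * b : ℂ)‖ = 1 := by simp [Circle.norm_coe]
  have : (a * b : ℂ) ^ 3 / ‖(a * b : ℂ)‖ * conj (a * a * b : ℂ) = a * b * b := by
    rw [hn]
    simp only [map_mul, Complex.ofReal_one, div_one]
    linear_combination (a * b ^ 3 * conj (b : ℂ) + a * b ^ 3 * conj (b : ℂ) * a * conj (a : ℂ)) * ha
      + a * b ^ 2 * hb
  rw [foldVec, this]
  congr 3
  ring

theorem tripleMap_pair (a b : Circle) {l : ℝ}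
    (hn : ‖!₂[(a * b : ℂ), (a * b * (a + b) / 2 : ℂ)]‖ = l) :
    (tripleMap a a b : EuclideanSpace ℂ (Fin 2)) =
      !₂[(a * b : ℂ) / l, (a * b * (a + b) / 2 : ℂ) / l] := by
  simp only [tripleMap, discParam_self_left, foldVec_pair, hn]
  ext i
  fin_cases i <;> simp <;> ring

theorem tripleMap_fold (a b : Circle) : tripleMap a a b = tripleMap a b b := by
  have h : tripleMap a b b = tripleMap b b a := by
    rw [tripleMap_swap_left, tripleMap_swap_right]
  have hv := foldVec_pair b a
  rw [mul_comm (b : ℂ) a, add_comm (b : ℂ) a, ← foldVec_pair] at hv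
  rw [h]
  unfold tripleMap
  simp only [discParam_self_left, mul_comm (b : ℂ) a, hv]

theorem eq_of_triple_eq {X Y : Type*} {f : X → X → X → Y} (h1 : ∀ a b c, f a b c = f b a c)
    (h2 : ∀ a b c, f a b c = f a c b) (h3 : ∀ a b, f a a b = f a b b) {a b c a' b' c' : X}
    (h : ({a, b, c} : Set X) = {a', b', c'}) : f a b c = f a' b' c' := by
  simp only [Set.ext_iff, Set.mem_insert_iff, Set.mem_singleton_iff] at h
  have ha := (h a).1 (by simp)
  have hb := (h b).1 (by simp)
  have hc := (h c).1 (by simp)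
  have ha' := (h a').2 (by simp)
  have hb' := (h b').2 (by simp)
  have hc' := (h c').2 (by simp)
  clear h
  rcases ha' with rfl | rfl | rfl <;> rcases hb' with rfl | rfl | rfl <;>
    rcases hc' with rfl | rfl | rfl <;> grind

theorem tripleMap_congr {a b c a' b' c' : Circle}
    (h : ({a, b, c} : Set Circle) = {a', b', c'}) : tripleMap a b c = tripleMap a' b' c' :=
  eq_of_triple_eq tripleMap_swap_left tripleMap_swap_right tripleMap_fold h

/-- On the circle the sum is the product times the conjugate of the second symmetric function, so
both triples are the roots of the same cubic. -/
theorem mem_triple_of_symmetric_eq {a b c a' b' c' : Circle}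
    (h3 : (a * b * c : ℂ) = a' * b' * c')
    (h2 : (a * b + b * c + c * a : ℂ) = a' * b' + b' * c' + c' * a') :
    a ∈ ({a', b', c'} : Set Circle) := by
  have key (a b c : Circle) :
      (a * b * c : ℂ) * conj (a * b + b * c + c * a : ℂ) = a + b + c := by
    have ha := Circle.coe_mul_conj a
    have hb := Circle.coe_mul_conj b
    have hc := Circle.coe_mul_conj c
    simp only [map_add, map_mul]
    linear_combination (c * (b * conj (b : ℂ)) + b * (c * conj (c : ℂ))) * ha
      + (c + a * (c * conj (c : ℂ))) * hb + (a + b) * hc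
  have h1 : (a + b + c : ℂ) = a' + b' + c' := by rw [← key, ← key, h3, h2]
  have h : ((a : ℂ) - a') * ((a - b') * (a - c')) = 0 := by
    linear_combination (-a ^ 2 : ℂ) * (-h1) + (-a : ℂ) * h2 + h3
  simp only [mul_eq_zero, sub_eq_zero, Circle.coe_inj] at h
  simpa using h

theorem triple_eq_of_symmetric_eq {a b c a' b' c' : Circle}
    (h3 : (a * b * c : ℂ) = a' * b' * c')
    (h2 : (a * b + b * c + c * a : ℂ) = a' * b' + b' * c' + c' * a') :
    ({a, b, c} : Set Circle) = {a', b', c'} := by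
  have key {a b c a' b' c' : Circle} (h3 : (a * b * c : ℂ) = a' * b' * c')
      (h2 : (a * b + b * c + c * a : ℂ) = a' * b' + b' * c' + c' * a') :
      ({a, b, c} : Set Circle) ⊆ {a', b', c'} := by
    rintro x (rfl | rfl | rfl)
    · exact mem_triple_of_symmetric_eq h3 h2
    · exact mem_triple_of_symmetric_eq (b := c) (c := a) (by rw [← h3]; ring) (by rw [← h2]; ring)
    · exact mem_triple_of_symmetric_eq (b := a) (c := b) (by rw [← h3]; ring) (by rw [← h2]; ring)
  exact (key h3 h2).antisymm (key h3.symm h2.symm)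

/-- On the boundary of the disc the triple degenerates to a pair. -/
theorem triple_eq_pair {a b c x y : Circle}
    (hx : (x * discParam a b c : ℂ) = a * b * c) (hy : (x * y : ℂ) = discParam a b c) :
    ({a, b, c} : Set Circle) = {x, y} := by
  have h3 : (a * b * c : ℂ) = x * x * y := by rw [← hx, ← hy]; ring
  have : ({a, b, c} : Set Circle) = {x, x, y} := by
    refine triple_eq_of_symmetric_eq h3 ?_
    rw [discParam_spec x x y, discParam_self_left, discParam_spec, hy, h3]
  rw [this]; simp

theorem triple_eq_of_tripleMap_eq {a b c a' b' c' : Circle}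
    (h : tripleMap a b c = tripleMap a' b' c') : ({a, b, c} : Set Circle) = {a', b', c'} := by
  have h := congrArg Subtype.val h
  simp only [tripleMap] at h
  set v := foldVec (discParam a b c) (a * b * c) with hv
  set v' := foldVec (discParam a' b' c') (a' * b' * c') with hv'
  have hv0 : 0 < ‖v‖ := norm_pos_iff.2 (foldVec_ne_zero (norm_circle_mul a b c))
  have hv0' : 0 < ‖v'‖ := norm_pos_iff.2 (foldVec_ne_zero (norm_circle_mul a' b' c'))
  have hvv : v' = ((‖v'‖ * ‖v‖⁻¹ : ℝ) : ℂ) • v := by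
    rw [Complex.ofReal_mul, mul_smul, h, ← mul_smul, ← Complex.ofReal_mul,
      mul_inv_cancel₀ hv0'.ne']
    simp
  obtain ⟨hw, hp | ⟨hn, hp⟩⟩ := foldVec_fiber (norm_circle_mul a b c) (norm_circle_mul a' b' c')
    (norm_discParam_le a b c) (norm_discParam_le a' b' c') (by positivity) hvv
  · refine triple_eq_of_symmetric_eq hp.symm ?_
    rw [discParam_spec, discParam_spec a' b' c', hw, hp]
  · have hw0 : discParam a b c ≠ 0 := norm_ne_zero_iff.1 (by rw [hn]; exact one_ne_zero)
    obtain ⟨W, hW⟩ : ∃ W : Circle, (W : ℂ) = discParam a b c :=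
      ⟨⟨_, mem_sphere_zero_iff_norm.2 hn⟩, rfl⟩
    rw [← hW] at hw hp
    have hW0 : (W : ℂ) ≠ 0 := W.coe_ne_zero
    have hp' : a * b * c * (a' * b' * c') = W ^ 3 := by
      rw [← Circle.coe_inj]; push_cast; exact hp
    have hx : ((a * b * c / W : Circle) * W : ℂ) = a * b * c := by
      push_cast; field_simp
    have hxy : ((a * b * c / W : Circle) * (a' * b' * c' / W : Circle) : ℂ) = W := by
      push_cast; field_simp; linear_combination hp
    -- For `w = xy` and `p = x²y` the doubled point is `x = p/w`. The relation `p p' = w³` makes the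
    -- other point `p'/w`, so the two triples are the same pair with the roles of `x` and `y`
    -- exchanged.
    rw [triple_eq_pair (x := a * b * c / W) (y := a' * b' * c' / W) (hW ▸ hx) (hW ▸ hxy),
      triple_eq_pair (a := a') (b := b') (c := c') (x := a' * b' * c' / W) (y := a * b * c / W)
        (by rw [hw]; push_cast; field_simp)
        (by rw [hw, mul_comm]; exact hxy), Set.pair_comm]

theorem tripleMap_surjective (s : ThreeSphere) : ∃ a b c, tripleMap a b c = s := by
  have hs : ‖(s : EuclideanSpace ℂ (Fin 2))‖ = 1 := mem_sphere_zero_iff_norm.1 s.2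
  have hs' : (s : EuclideanSpace ℂ (Fin 2)) = !₂[s.1 0, s.1 1] := by
    ext i; fin_cases i <;> rfl
  obtain ⟨w, p, l, hw, hp, hl, h⟩ := exists_foldVec_eq (f := s.1 0) (g := s.1 1) (by
    rintro ⟨h0, h1⟩
    rw [hs', h0, h1] at hs
    simp [EuclideanSpace.norm_eq] at hs)
  obtain ⟨a, b, c, h3, h2⟩ := exists_circle_triple hw hp
  refine ⟨a, b, c, Subtype.ext ?_⟩
  have hd : discParam a b c = w := discParam_eq hw (by rw [h2, h3])
  rw [← hs'] at h
  have hn : ‖foldVec w p‖ = l := by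
    rw [h, norm_smul, hs, Complex.norm_real, Real.norm_of_nonneg hl.le, mul_one]
  simp only [tripleMap, hd, h3, hn]
  rw [h, ← mul_smul, ← Complex.ofReal_mul, inv_mul_cancel₀ hl.ne']
  simp

theorem continuous_tripleMap :
    Continuous fun x : Fin 3 → Circle => tripleMap (x 0) (x 1) (x 2) := by
  have h : Continuous fun x : Fin 3 → Circle =>
      foldVec (discParam (x 0) (x 1) (x 2)) (x 0 * x 1 * x 2) :=
    continuous_foldVec.comp (continuous_discParam.prodMk (by fun_prop))
  refine Continuous.subtype_mk ?_ _
  refine Continuous.smul (Complex.continuous_ofReal.comp (h.norm.inv₀ fun x => ?_)) h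
  exact norm_ne_zero_iff.2 (foldVec_ne_zero (norm_circle_mul _ _ _))

/-! ### Descent to the quotient -/

namespace SymmetricPotency

theorem proj_surjective (k : ℕ) [NeZero k] (X : Type*) : Function.Surjective (proj k X) := by
  rintro ⟨A, hne, hcard⟩
  have hfin : A.Finite := Set.finite_of_encard_le_coe hcard
  have := hfin.fintype
  have := hne.to_subtype
  obtain ⟨f⟩ : Nonempty (A ↪ Fin k) := by
    rw [Function.Embedding.nonempty_iff_card_le, Fintype.card_fin, ← Nat.card_eq_fintype_card,
      Nat.card_coe_set_eq]
    rw [← hfin.cast_ncard_eq] at hcard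
    exact_mod_cast hcard
  let g : Fin k → A := Function.invFun f
  refine ⟨Subtype.val ∘ g, Subtype.ext ?_⟩
  change Set.range (Subtype.val ∘ g) = A
  rw [Set.range_comp, (Function.invFun_surjective f.injective).range_eq]
  simp

theorem continuous_proj (k : ℕ) [NeZero k] (X : Type*) [TopologicalSpace X] :
    Continuous (proj k X) := continuous_coinduced_rng

instance (k : ℕ) [NeZero k] (X : Type*) [TopologicalSpace X] [CompactSpace X] :
    CompactSpace (SymmetricPotency k X) where
  isCompact_univ := by
    rw [← (proj_surjective k X).range_eq]
    exact isCompact_range (continuous_proj k X)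

theorem proj_three_eq_iff {X : Type*} {x y : Fin 3 → X} :
    proj 3 X x = proj 3 X y ↔ ({x 0, x 1, x 2} : Set X) = {y 0, y 1, y 2} := by
  have (x : Fin 3 → X) : Set.range x = {x 0, x 1, x 2} := by
    ext a; simp [Fin.exists_fin_succ, eq_comm]
  rw [← this, ← this]
  exact Subtype.ext_iff

/-- The map induced by `tripleMap` on the third symmetric potency of the circle. -/
noncomputable def toSphere (A : SymmetricPotency 3 Circle) : ThreeSphere :=
  tripleMap ((proj_surjective 3 Circle A).choose 0) ((proj_surjective 3 Circle A).choose 1)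
    ((proj_surjective 3 Circle A).choose 2)

theorem toSphere_proj (x : Fin 3 → Circle) :
    toSphere (proj 3 Circle x) = tripleMap (x 0) (x 1) (x 2) :=
  tripleMap_congr (proj_three_eq_iff.1 (proj_surjective 3 Circle (proj 3 Circle x)).choose_spec)

theorem continuous_toSphere : Continuous toSphere := by
  refine continuous_coinduced_dom.2 ?_
  convert continuous_tripleMap using 1
  exact funext toSphere_proj

theorem toSphere_bijective : Function.Bijective toSphere := by
  constructor
  · intro A B h
    obtain ⟨x, rfl⟩ := proj_surjective 3 Circle A
    obtain ⟨y, rfl⟩ := proj_surjective 3 Circle B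
    rw [toSphere_proj, toSphere_proj] at h
    exact proj_three_eq_iff.2 (triple_eq_of_tripleMap_eq h)
  · intro s
    obtain ⟨a, b, c, h⟩ := tripleMap_surjective s
    exact ⟨proj 3 Circle ![a, b, c], (toSphere_proj _).trans h⟩

/-- The third symmetric potency of the circle is the 3-sphere. -/
noncomputable def homeoSphere : SymmetricPotency 3 Circle ≃ₜ ThreeSphere :=
  Continuous.homeoOfEquivCompactToT2 (f := Equiv.ofBijective toSphere toSphere_bijective)
    continuous_toSphere

theorem homeoSphere_proj (x : Fin 3 → Circle) :
    homeoSphere (proj 3 Circle x) = tripleMap (x 0) (x 1) (x 2) := toSphere_proj x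

end SymmetricPotency

namespace SymmetricPotency

theorem inclusion_two_three {X : Type*} (h : 2 ≤ 3) (x : Fin 2 → X) :
    inclusion h X (proj 2 X x) = proj 3 X ![x 0, x 0, x 1] := by
  refine Subtype.ext ?_
  ext a
  simp [inclusion, proj, Fin.exists_fin_succ, eq_comm, or_comm]

theorem inclusion_one_three {X : Type*} (h : 1 ≤ 3) (x : Fin 1 → X) :
    inclusion h X (proj 1 X x) = proj 3 X ![x 0, x 0, x 0] := by
  refine Subtype.ext ?_
  ext a
  simp [inclusion, proj, Fin.exists_fin_succ, eq_comm, or_comm]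

theorem inclusion_one_two {X : Type*} (h : 1 ≤ 2) (x : Fin 1 → X) :
    inclusion h X (proj 1 X x) = proj 2 X ![x 0, x 0] := by
  refine Subtype.ext ?_
  ext a
  simp [inclusion, proj, Fin.exists_fin_succ, eq_comm, or_comm]

end SymmetricPotency

/-! ### The image of the second symmetric potency in the 3-sphere -/

theorem exp_add_add_exp_sub (μ δ : ℝ) :
    (Circle.exp (μ + δ) : ℂ) + Circle.exp (μ - δ) =
      (2 * Real.cos δ : ℝ) * Complex.exp (μ * Complex.I) := by
  have h1 : ((μ + δ : ℝ) : ℂ) * Complex.I = μ * Complex.I + δ * Complex.I := by push_cast; ring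
  have h2 : ((μ - δ : ℝ) : ℂ) * Complex.I = μ * Complex.I + -δ * Complex.I := by push_cast; ring
  rw [Circle.coe_exp, Circle.coe_exp, h1, h2, Complex.exp_add, Complex.exp_add]
  push_cast
  rw [Complex.two_cos]
  ring

theorem exp_add_mul_exp_sub (μ δ : ℝ) :
    (Circle.exp (μ + δ) : ℂ) * Circle.exp (μ - δ) = Complex.exp ((2 * μ : ℝ) * Complex.I) := by
  rw [Circle.coe_exp, Circle.coe_exp, ← Complex.exp_add]
  congr 1
  push_cast
  ring

/-- Normalizing `(e^{2iμ}, cos δ e^{3iμ})` divides by `√(1 + cos² δ)`, which is why the fibre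
coordinate is `arctan (cos δ)`. In terms of `θ = 2μ` the normal direction turns as `e^{3iθ/2}`. -/
theorem tripleMap_eq_bandPoint (μ δ : ℝ) :
    (tripleMap (Circle.exp (μ + δ)) (Circle.exp (μ + δ)) (Circle.exp (μ - δ)) :
      EuclideanSpace ℂ (Fin 2)) = bandPoint 3 (2 * μ) (Real.arctan (Real.cos δ)) := by
  have hs := exp_add_add_exp_sub μ δ
  have hm := exp_add_mul_exp_sub μ δ
  have he : Complex.exp ((2 * μ : ℝ) * Complex.I) * Complex.exp (μ * Complex.I) =
      Complex.exp (((3 : ℤ) * (2 * μ) / 2 : ℝ) * Complex.I) := by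
    rw [← Complex.exp_add]; congr 1; push_cast; ring
  have hv : !₂[(Circle.exp (μ + δ) * Circle.exp (μ - δ) : ℂ),
      (Circle.exp (μ + δ) * Circle.exp (μ - δ) *
        (Circle.exp (μ + δ) + Circle.exp (μ - δ)) / 2 : ℂ)] =
      (!₂[Complex.exp ((2 * μ : ℝ) * Complex.I),
        Real.cos δ * Complex.exp (((3 : ℤ) * (2 * μ) / 2 : ℝ) * Complex.I)] :
        EuclideanSpace ℂ (Fin 2)) := by
    rw [hs, hm, ← he]
    congr 3
    push_cast
    ring
  have hl : ‖(!₂[Complex.exp ((2 * μ : ℝ) * Complex.I),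
        Real.cos δ * Complex.exp (((3 : ℤ) * (2 * μ) / 2 : ℝ) * Complex.I)] :
        EuclideanSpace ℂ (Fin 2))‖ = √(1 + Real.cos δ ^ 2) := by
    rw [EuclideanSpace.norm_eq, Fin.sum_univ_two]
    congr 1
    change ‖Complex.exp ((2 * μ : ℝ) * Complex.I)‖ ^ 2 + ‖(Real.cos δ : ℂ) *
      Complex.exp (((3 : ℤ) * (2 * μ) / 2 : ℝ) * Complex.I)‖ ^ 2 = _
    rw [norm_mul, Complex.norm_exp_ofReal_mul_I, Complex.norm_exp_ofReal_mul_I, Complex.norm_real]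
    simp
  rw [tripleMap_pair _ _ ((congrArg norm hv).trans hl), bandPoint, Real.cos_arctan,
    Real.sin_arctan, hs, hm, ← he]
  congr 3
  · push_cast; ring
  · push_cast; ring

theorem tripleMap_self (z : Circle) : tripleMap z z z = trefoil z := by
  refine Subtype.ext ?_
  have hn : ‖!₂[(z * z : ℂ), (z * z * (z + z) / 2 : ℂ)]‖ = √2 := by
    rw [EuclideanSpace.norm_eq, Fin.sum_univ_two]
    congr 1
    have : (z * z * (z + z) / 2 : ℂ) = z ^ 3 := by ring
    rw [this]
    simp [Circle.norm_coe]
    norm_num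
  rw [tripleMap_pair z z hn, trefoil]
  congr 3
  · ring
  · congr 1; ring

theorem abs_arctan_le_of_abs_le_one {x : ℝ} (h : |x| ≤ 1) : |Real.arctan x| ≤ Real.pi / 4 := by
  rw [abs_le] at h ⊢
  rw [← Real.arctan_one, ← Real.arctan_neg]
  exact ⟨Real.arctan_strictMono.monotone h.1, Real.arctan_strictMono.monotone h.2⟩

theorem exists_arctan_cos_eq {φ : ℝ} (h : |φ| ≤ Real.pi / 4) :
    ∃ δ, Real.arctan (Real.cos δ) = φ := by
  have hpi := Real.pi_pos
  rw [abs_le] at h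
  have h1 : -(Real.pi / 2) < φ := by linarith
  have h2 : φ < Real.pi / 2 := by linarith
  have ht := Real.arctan_tan h1 h2
  have hle : |Real.tan φ| ≤ 1 := by
    rw [← ht, ← Real.arctan_one, ← Real.arctan_neg] at h
    rw [abs_le]
    exact ⟨Real.arctan_strictMono.le_iff_le.1 h.1, Real.arctan_strictMono.le_iff_le.1 h.2⟩
  rw [abs_le] at hle
  exact ⟨Real.arccos (Real.tan φ), by rw [Real.cos_arccos hle.1 hle.2, ht]⟩

theorem exists_exp_add_sub (a b : Circle) :
    ∃ μ δ : ℝ, Circle.exp (μ + δ) = a ∧ Circle.exp (μ - δ) = b := by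
  refine ⟨(Complex.arg a + Complex.arg b) / 2, (Complex.arg a - Complex.arg b) / 2, ?_, ?_⟩
  · convert Circle.exp_arg a using 2; ring
  · convert Circle.exp_arg b using 2; ring

namespace SymmetricPotency

theorem homeoSphere_image_two (h : 2 ≤ 3) :
    homeoSphere '' Set.range (inclusion h Circle) = standardBand 3 := by
  rw [← Set.range_comp]
  ext p
  constructor
  · rintro ⟨A, rfl⟩
    obtain ⟨x, rfl⟩ := proj_surjective 2 Circle A
    obtain ⟨μ, δ, h0, h1⟩ := exists_exp_add_sub (x 0) (x 1)
    refine ⟨2 * μ, Real.arctan (Real.cos δ),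
      abs_arctan_le_of_abs_le_one (Real.abs_cos_le_one δ), ?_⟩
    rw [Function.comp_apply, inclusion_two_three, homeoSphere_proj, ← tripleMap_eq_bandPoint,
      h0, h1]
    rfl
  · rintro ⟨θ, φ, hφ, hp⟩
    obtain ⟨δ, rfl⟩ := exists_arctan_cos_eq hφ
    refine ⟨proj 2 Circle ![Circle.exp (θ / 2 + δ), Circle.exp (θ / 2 - δ)], Subtype.ext ?_⟩
    rw [Function.comp_apply, inclusion_two_three, homeoSphere_proj, hp]
    refine (tripleMap_eq_bandPoint (θ / 2) δ).trans ?_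
    rw [mul_div_cancel₀ θ two_ne_zero]

theorem homeoSphere_image_one (h : 1 ≤ 3) :
    homeoSphere '' Set.range (inclusion h Circle) = standardBandEdge 3 := by
  have hpi := Real.pi_pos
  rw [← Set.range_comp]
  ext p
  constructor
  · rintro ⟨A, rfl⟩
    obtain ⟨x, rfl⟩ := proj_surjective 1 Circle A
    obtain ⟨μ, h0⟩ : ∃ μ, Circle.exp μ = x 0 := ⟨_, Circle.exp_arg (x 0)⟩
    refine ⟨2 * μ, Real.arctan (Real.cos 0), ?_, ?_⟩
    · rw [Real.cos_zero, Real.arctan_one, abs_of_pos (by positivity)]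
    · rw [Function.comp_apply, inclusion_one_three, homeoSphere_proj, ← tripleMap_eq_bandPoint,
        add_zero, sub_zero, h0]
      rfl
  · rintro ⟨θ, φ, hφ, hp⟩
    obtain ⟨δ, hδ, hδ'⟩ : ∃ δ, Real.arctan (Real.cos δ) = φ ∧
        Circle.exp (θ / 2 + δ) = Circle.exp (θ / 2 - δ) := by
      rcases eq_or_eq_neg_of_abs_eq hφ with rfl | rfl
      · exact ⟨0, by simp, by simp⟩
      -- Opposite displacements by `π` meet again, so this end of the fibre is also a single point.
      · refine ⟨Real.pi, by simp, ?_⟩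
        rw [← Circle.exp_add_two_pi (θ / 2 - Real.pi)]
        congr 1
        ring
    refine ⟨proj 1 Circle fun _ => Circle.exp (θ / 2 + δ), Subtype.ext ?_⟩
    rw [Function.comp_apply, inclusion_one_three, homeoSphere_proj, hp, ← hδ]
    have := tripleMap_eq_bandPoint (θ / 2) δ
    rw [← hδ', mul_div_cancel₀ θ two_ne_zero] at this
    exact this

theorem homeoSphere_point (h : 1 ≤ 3) (z : Circle) :
    homeoSphere (point h Circle z) = trefoil z := by
  rw [point, inclusion_one_three, homeoSphere_proj]
  exact tripleMap_self z

/-! ### The second symmetric potency of the circle -/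

theorem proj_two_eq_iff {X : Type*} {x y : Fin 2 → X} :
    proj 2 X x = proj 2 X y ↔ ({x 0, x 1} : Set X) = {y 0, y 1} := by
  have (x : Fin 2 → X) : Set.range x = {x 0, x 1} := by
    ext a; simp [Fin.exists_fin_succ, eq_comm]
  rw [← this, ← this]
  exact Subtype.ext_iff

/-- The product and the sum of a pair of points of the circle. -/
noncomputable def prodSum (A : SymmetricPotency 2 Circle) : ℂ × ℂ :=
  let x := (proj_surjective 2 Circle A).choose
  (x 0 * x 1, x 0 + x 1)

theorem prodSum_proj (x : Fin 2 → Circle) :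
    prodSum (proj 2 Circle x) = ((x 0 * x 1 : ℂ), (x 0 + x 1 : ℂ)) := by
  have h := proj_two_eq_iff.1 (proj_surjective 2 Circle (proj 2 Circle x)).choose_spec
  simp only [prodSum]
  rcases Set.pair_eq_pair_iff.1 h with ⟨h0, h1⟩ | ⟨h0, h1⟩
  · rw [h0, h1]
  · rw [h0, h1, mul_comm, add_comm]

/-- Product and sum determine the quadratic with these two roots. Together with continuity this
makes the space of pairs Hausdorff and reduces equality of pairs to complex identities. -/
theorem prodSum_injective : Function.Injective prodSum := by
  intro A B h
  obtain ⟨x, rfl⟩ := proj_surjective 2 Circle A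
  obtain ⟨y, rfl⟩ := proj_surjective 2 Circle B
  rw [prodSum_proj, prodSum_proj, Prod.mk.injEq] at h
  obtain ⟨hm, hs⟩ := h
  rw [proj_two_eq_iff, Set.pair_eq_pair_iff]
  have h0 : ((x 0 : ℂ) - y 0) * (x 0 - y 1) = 0 := by
    linear_combination (x 0 : ℂ) * hs - hm
  rcases mul_eq_zero.1 h0 with h0 | h0
  · have h0 := sub_eq_zero.1 h0
    exact Or.inl ⟨Circle.ext h0, Circle.ext (by linear_combination hs - h0)⟩
  · have h0 := sub_eq_zero.1 h0
    exact Or.inr ⟨Circle.ext h0, Circle.ext (by linear_combination hs - h0)⟩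

theorem continuous_prodSum : Continuous prodSum := by
  refine continuous_coinduced_dom.2 ?_
  have : prodSum ∘ proj 2 Circle = fun x => ((x 0 * x 1 : ℂ), (x 0 + x 1 : ℂ)) :=
    funext prodSum_proj
  rw [this]
  fun_prop

instance : T2Space (SymmetricPotency 2 Circle) :=
  T2Space.of_injective_continuous prodSum_injective continuous_prodSum

end SymmetricPotency

/-! ### The Möbius band as the space of pairs -/

namespace MobiusBand

open SymmetricPotency

instance : CompactSpace MobiusBand where
  isCompact_univ := by
    have h : Function.Surjective mk := Quot.mk_surjective
    rw [← h.range_eq]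
    exact isCompact_range continuous_coinduced_rng

/-- The pair of points of the circle at angular distance `(1 - t)π/2` from `e^{iπs}`. -/
noncomputable def pair (p : unitInterval × Set.Icc (-1 : ℝ) 1) : SymmetricPotency 2 Circle :=
  proj 2 Circle ![Circle.exp (Real.pi * p.1 + (1 - p.2) * (Real.pi / 2)),
    Circle.exp (Real.pi * p.1 - (1 - p.2) * (Real.pi / 2))]

theorem continuous_pair : Continuous pair := by
  refine (continuous_proj 2 Circle).comp (continuous_pi fun i => ?_)
  fin_cases i
  · exact Circle.exp.continuous.comp (by fun_prop)
  · exact Circle.exp.continuous.comp (by fun_prop)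

theorem prodSum_pair (p : unitInterval × Set.Icc (-1 : ℝ) 1) :
    prodSum (pair p) = (Complex.exp ((2 * (Real.pi * p.1) : ℝ) * Complex.I),
      (2 * Real.sin (p.2 * (Real.pi / 2)) : ℝ) * Complex.exp ((Real.pi * p.1 : ℝ) * Complex.I)) := by
  have h : Real.cos ((1 - p.2) * (Real.pi / 2)) = Real.sin (p.2 * (Real.pi / 2)) := by
    rw [← Real.cos_pi_div_two_sub]; congr 1; ring
  rw [pair, prodSum_proj, ← exp_add_mul_exp_sub _ ((1 - p.2) * (Real.pi / 2)), ← h,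
    ← exp_add_add_exp_sub]
  rfl

theorem pair_eq_of_rel {p q : unitInterval × Set.Icc (-1 : ℝ) 1} (hp : p.1 = 0) (hq : q.1 = 1)
    (h : (q.2 : ℝ) = -(p.2 : ℝ)) : pair p = pair q := by
  refine prodSum_injective ?_
  rw [prodSum_pair, prodSum_pair, hp, hq, h, neg_mul, Real.sin_neg]
  simp [Complex.exp_pi_mul_I, Complex.exp_two_pi_mul_I]

theorem injOn_sin_mul {t t' : Set.Icc (-1 : ℝ) 1}
    (h : Real.sin (t * (Real.pi / 2)) = Real.sin (t' * (Real.pi / 2))) : t = t' := by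
  have hpi := Real.pi_pos
  have hmem (t : Set.Icc (-1 : ℝ) 1) :
      (t : ℝ) * (Real.pi / 2) ∈ Set.Icc (-(Real.pi / 2)) (Real.pi / 2) :=
    ⟨by nlinarith [t.2.1], by nlinarith [t.2.2]⟩
  have := Real.injOn_sin (hmem t) (hmem t') h
  exact Subtype.ext (mul_right_cancel₀ (by positivity) this)

theorem mk_eq_of_pair_eq {p q : unitInterval × Set.Icc (-1 : ℝ) 1} (h : pair p = pair q) :
    mk p = mk q := by
  have hpi : Real.pi ≠ 0 := Real.pi_ne_zero
  have h := congrArg prodSum h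
  rw [prodSum_pair, prodSum_pair, Prod.mk.injEq, Complex.exp_eq_exp_iff_exists_int] at h
  obtain ⟨⟨n, hn⟩, hs⟩ := h
  have hn : (p.1 : ℝ) = q.1 + n := by
    have : ((2 * (Real.pi * p.1) : ℝ) : ℂ) = (2 * (Real.pi * q.1) + n * (2 * Real.pi) : ℝ) := by
      refine mul_right_cancel₀ Complex.I_ne_zero (hn.trans ?_)
      push_cast; ring
    have := Complex.ofReal_injective this
    refine mul_left_cancel₀ (mul_ne_zero two_ne_zero hpi) ?_
    linear_combination this
  -- Equal products fix the first coordinate up to an integer in `{-1, 0, 1}`. A shift by one puts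
  -- the points on opposite ends, where `e^{iπ} = -1` in the sums gives opposite second coordinates.
  have glue {p q : unitInterval × Set.Icc (-1 : ℝ) 1} (hp : (p.1 : ℝ) = q.1 + 1)
      (hs : ((2 * Real.sin (p.2 * (Real.pi / 2)) : ℝ) : ℂ) *
          Complex.exp ((Real.pi * p.1 : ℝ) * Complex.I) =
        (2 * Real.sin (q.2 * (Real.pi / 2)) : ℝ) * Complex.exp ((Real.pi * q.1 : ℝ) * Complex.I)) :
      mk q = mk p := by
    have hp1 : p.1 = 1 := Subtype.ext (le_antisymm p.1.2.2 (by rw [hp]; simpa using q.1.2.1))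
    have hq0 : q.1 = 0 := Subtype.ext (by rw [hp1] at hp; simpa using hp)
    refine Quot.sound ⟨hq0, hp1, ?_⟩
    rw [hp1, hq0] at hs
    simp only [Set.Icc.coe_one, Set.Icc.coe_zero, mul_one, mul_zero, Complex.exp_pi_mul_I,
      Complex.ofReal_zero, zero_mul, Complex.exp_zero] at hs
    have hs' : Real.sin (p.2 * (Real.pi / 2)) = Real.sin (-q.2 * (Real.pi / 2)) := by
      rw [neg_mul, Real.sin_neg]
      have : -(2 * Real.sin (p.2 * (Real.pi / 2))) = 2 * Real.sin (q.2 * (Real.pi / 2)) := by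
        have : ((-(2 * Real.sin (p.2 * (Real.pi / 2))) : ℝ) : ℂ) =
            (2 * Real.sin (q.2 * (Real.pi / 2)) : ℝ) := by
          rw [← hs]; push_cast; ring
        exact Complex.ofReal_injective this
      linarith
    have hneg : -(q.2 : ℝ) ∈ Set.Icc (-1 : ℝ) 1 := ⟨by linarith [q.2.2.2], by linarith [q.2.2.1]⟩
    exact congrArg Subtype.val (injOn_sin_mul (t := p.2) (t' := ⟨_, hneg⟩) hs')
  have hn1 : n ≤ 1 := by
    have : (n : ℝ) ≤ 1 := by linarith [p.1.2.2, q.1.2.1]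
    exact_mod_cast this
  have hn2 : -1 ≤ n := by
    have : (-1 : ℝ) ≤ n := by linarith [p.1.2.1, q.1.2.2]
    exact_mod_cast this
  interval_cases n
  · exact glue (by rw [hn]; push_cast; ring) hs.symm
  · have h1 : p.1 = q.1 := Subtype.ext (by simpa using hn)
    rw [h1] at hs
    have h2 := Complex.ofReal_injective (mul_right_cancel₀ (Complex.exp_ne_zero _) hs)
    have h2 : p.2 = q.2 := injOn_sin_mul (by linarith)
    rw [Prod.ext h1 h2]
  · exact (glue (by simpa using hn) hs).symm

theorem pair_surjective : Function.Surjective pair := by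
  intro A
  obtain ⟨x, rfl⟩ := proj_surjective 2 Circle A
  obtain ⟨μ, δ, h0, h1⟩ := exists_exp_add_sub (x 0) (x 1)
  have hpi : Real.pi ≠ 0 := Real.pi_ne_zero
  set n := ⌊μ / Real.pi⌋
  -- Reducing the midpoint angle modulo `π` may replace the midpoint by its antipode; the sign
  -- compensates in the sum, and `t` is then found from `sin (tπ/2) = κ`.
  let κ : ℝ := Real.cos δ * (-1) ^ n
  have hsq : ((-1 : ℝ) ^ n) ^ 2 = 1 := by
    rw [← zpow_natCast, ← zpow_mul, mul_comm, zpow_mul]; simp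
  have hκ : κ ∈ Set.Icc (-1 : ℝ) 1 := by
    rw [Set.mem_Icc, ← abs_le, ← sq_le_one_iff_abs_le_one]
    simp only [κ, mul_pow, hsq, mul_one]
    exact Real.cos_sq_le_one δ
  have ht : 2 / Real.pi * Real.arcsin κ ∈ Set.Icc (-1 : ℝ) 1 := by
    have h1 := Real.neg_pi_div_two_le_arcsin κ
    have h2 := Real.arcsin_le_pi_div_two κ
    have h3 : 0 ≤ 2 / Real.pi := by positivity
    have h4 : 2 / Real.pi * (Real.pi / 2) = 1 := by field_simp
    exact ⟨by nlinarith, by nlinarith⟩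
  have hμ : Real.pi * Int.fract (μ / Real.pi) = μ - n * Real.pi := by
    rw [Int.fract]; simp only [n]; field_simp
  refine ⟨(⟨Int.fract (μ / Real.pi), Int.fract_nonneg _, (Int.fract_lt_one _).le⟩, ⟨_, ht⟩),
    prodSum_injective ?_⟩
  have hsin : Real.sin (2 / Real.pi * Real.arcsin κ * (Real.pi / 2)) = κ := by
    rw [show 2 / Real.pi * Real.arcsin κ * (Real.pi / 2) = Real.arcsin κ by field_simp,
      Real.sin_arcsin hκ.1 hκ.2]
  have hexp : Complex.exp ((n * Real.pi : ℝ) * Complex.I) = ((-1 : ℝ) ^ n : ℝ) := by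
    rw [Complex.exp_mul_I, ← Complex.ofReal_cos, ← Complex.ofReal_sin, Real.sin_int_mul_pi,
      Real.cos_int_mul_pi]
    simp
  have hexp' : Complex.exp (μ * Complex.I) =
      Complex.exp ((μ - n * Real.pi : ℝ) * Complex.I) * ((-1 : ℝ) ^ n : ℝ) := by
    rw [← hexp, ← Complex.exp_add]; congr 1; push_cast; ring
  rw [prodSum_pair, prodSum_proj, ← h0, ← h1, exp_add_mul_exp_sub, exp_add_add_exp_sub]
  simp only [hμ, hsin]
  refine Prod.ext ?_ ?_
  · refine Complex.exp_eq_exp_iff_exists_int.2 ⟨-n, ?_⟩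
    push_cast; ring
  · rw [hexp']
    simp only [κ]
    push_cast
    ring

/-- The homeomorphism from the Möbius band to the second symmetric potency of the circle. -/
noncomputable def homeoPairs : MobiusBand ≃ₜ SymmetricPotency 2 Circle :=
  Continuous.homeoOfEquivCompactToT2
    (f := Equiv.ofBijective (Quot.lift pair fun _ _ h => pair_eq_of_rel h.1 h.2.1 h.2.2)
      ⟨by
        rintro ⟨p⟩ ⟨q⟩ h
        exact mk_eq_of_pair_eq h,
      fun A => (pair_surjective A).elim fun p hp => ⟨mk p, hp⟩⟩)
    (continuous_coinduced_dom.2 continuous_pair)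

theorem proj_two_mem_range_inclusion (h : 1 ≤ 2) {X : Type*} (x : Fin 2 → X) :
    proj 2 X x ∈ Set.range (inclusion h X) ↔ x 0 = x 1 := by
  constructor
  · rintro ⟨A, hA⟩
    obtain ⟨y, rfl⟩ := proj_surjective 1 X A
    rw [inclusion_one_two, proj_two_eq_iff] at hA
    have h0 : x 0 ∈ ({y 0, y 0} : Set X) := by
      change x 0 ∈ ({![y 0, y 0] 0, ![y 0, y 0] 1} : Set X); rw [hA]; simp
    have h1 : x 1 ∈ ({y 0, y 0} : Set X) := by
      change x 1 ∈ ({![y 0, y 0] 0, ![y 0, y 0] 1} : Set X); rw [hA]; simp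
    simp only [Set.pair_eq_singleton, Set.mem_singleton_iff] at h0 h1
    rw [h0, h1]
  · intro hx
    refine ⟨proj 1 X fun _ => x 0, ?_⟩
    rw [inclusion_one_two, proj_two_eq_iff]
    simp [hx]

theorem prodSum_discriminant (x : Fin 2 → Circle) :
    (prodSum (proj 2 Circle x)).2 ^ 2 = 4 * (prodSum (proj 2 Circle x)).1 ↔ x 0 = x 1 := by
  have h : (x 0 + x 1 : ℂ) ^ 2 - 4 * (x 0 * x 1) = (x 0 - x 1 : ℂ) ^ 2 := by ring
  rw [prodSum_proj, ← sub_eq_zero, h, pow_eq_zero_iff two_ne_zero, sub_eq_zero, Circle.coe_inj]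

theorem cos_mul_eq_zero_iff (t : Set.Icc (-1 : ℝ) 1) :
    Real.cos (t * (Real.pi / 2)) = 0 ↔ |(t : ℝ)| = 1 := by
  have hpi := Real.pi_pos
  constructor
  · intro h
    refine le_antisymm (abs_le.2 t.2) (not_lt.1 fun hlt => ?_)
    rw [abs_lt] at hlt
    exact (Real.cos_pos_of_mem_Ioo ⟨by nlinarith, by nlinarith⟩).ne' h
  · intro h
    rw [← Real.cos_abs, abs_mul, h, abs_of_pos (by positivity), one_mul, Real.cos_pi_div_two]

/-- The two points coincide when the squared sum is four times the product, that is when `sin²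
(tπ/2) = 1`. -/
theorem pair_mem_range_inclusion (h : 1 ≤ 2) (p : unitInterval × Set.Icc (-1 : ℝ) 1) :
    pair p ∈ Set.range (inclusion h Circle) ↔ |(p.2 : ℝ)| = 1 := by
  have hsq : Complex.exp ((Real.pi * p.1 : ℝ) * Complex.I) ^ 2 =
      Complex.exp ((2 * (Real.pi * p.1) : ℝ) * Complex.I) := by
    rw [← Complex.exp_nat_mul]; congr 1; push_cast; ring
  rw [← cos_mul_eq_zero_iff, ← pow_eq_zero_iff (n := 2) two_ne_zero, Real.cos_sq', pair,
    proj_two_mem_range_inclusion, ← prodSum_discriminant, ← pair, prodSum_pair]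
  simp only [mul_pow, hsq]
  rw [mul_left_inj' (Complex.exp_ne_zero _)]
  norm_cast
  constructor <;> intro h <;> linarith

theorem homeoPairs_image_boundary (h : 1 ≤ 2) :
    homeoPairs '' boundary = Set.range (inclusion h Circle) := by
  ext A
  constructor
  · rintro ⟨_, ⟨p, hp, rfl⟩, rfl⟩
    exact (pair_mem_range_inclusion h p).2 hp
  · intro hA
    obtain ⟨p, rfl⟩ := pair_surjective A
    exact ⟨mk p, ⟨p, (pair_mem_range_inclusion h p).1 hA, rfl⟩, rfl⟩

end MobiusBand

theorem mainTheorem1 :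
    Nonempty (SymmetricPotency 3 Circle ≃ₜ ThreeSphere) ∧
    (∃ m : SymmetricPotency 2 Circle ≃ₜ MobiusBand,
      m '' Set.range (SymmetricPotency.inclusion (show 1 ≤ 2 by norm_num) Circle) =
        MobiusBand.boundary) ∧
    ∀ Φ : SymmetricPotency 3 Circle ≃ₜ ThreeSphere,
      IsHalfTwistedBand 3
        (Φ '' Set.range (SymmetricPotency.inclusion (show 2 ≤ 3 by norm_num) Circle))
        (Φ '' Set.range (SymmetricPotency.inclusion (show 1 ≤ 3 by norm_num) Circle)) ∧
      IsTrefoilKnot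
        (fun z => Φ (SymmetricPotency.point (show 1 ≤ 3 by norm_num) Circle z)) := by
  refine ⟨⟨SymmetricPotency.homeoSphere⟩, ⟨MobiusBand.homeoPairs.symm, ?_⟩, fun Φ => ?_⟩
  · rw [← MobiusBand.homeoPairs_image_boundary, ← Set.image_comp]
    simp
  -- Composing the inverse of `Φ` with the explicit homeomorphism gives a self-homeomorphism of the
  -- sphere that carries every image under `Φ` to the explicit one; this single map serves for the
  -- band, its edge and the knot.
  · have himage (S : Set (SymmetricPotency 3 Circle)) :
        Φ.symm.trans SymmetricPotency.homeoSphere '' (Φ '' S) =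
          SymmetricPotency.homeoSphere '' S := by
      rw [← Set.image_comp]
      congr 1
      ext x
      simp
    refine ⟨⟨Φ.symm.trans SymmetricPotency.homeoSphere, ?_, ?_⟩,
      Φ.symm.trans SymmetricPotency.homeoSphere, fun z => ?_⟩
    · rw [himage, SymmetricPotency.homeoSphere_image_two]
    · rw [himage, SymmetricPotency.homeoSphere_image_one]
    · simp [SymmetricPotency.homeoSphere_point]
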